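/- Let $N\in\mathbb N$, let $\Omega\subset\mathbb R^N$ be a bounded open set, let $T>0$, $0<c<1$, $\eta>0$ and $0<\varepsilon\le\eta$. Put $\Omega_T=\Omega\times(0,T]$ and, for $r>0$, $$\Gamma_r=\Omega_r\times(-r^2,0]\ \cup\ \Theta_r\times(0,T],\qquad \Omega_r=\{x:\operatorname{dist}(x,\Omega)\le r\},\quad \Theta_r=\{x\in\mathbb R^N\setminus\Omega:\operatorname{dist}(x,\partial\Omega)\le r\}.$$ For every $(x,t)\in\Omega_T$ let $\mathcal A(x,t)$ be a compact subset of $B(0,1)\times[-\tfrac c2,\tfrac c2]$, where $B(0,1)$ is the open unit ball of $\mathbb R^N$, with $(0,0)\in\mathcal A(x,t)$, and let $$\mathcal A_\varepsilon(x,t)=\Big\{(x,t)+\Big(\varepsilon y,\ \varepsilon^2\tfrac{1-c}{c}s-\varepsilon^2\tfrac{c+1}{2}\Big):(y,s)\in\mathcal A(x,t)\Big\}.$$ Let $F:\Gamma_\eta\to\mathbb R$ be a bounded Borel function. The game: a token starts at $(x_0,t_0)\in\Omega_T$. In each round a fair coin is tossed (independently of the past), and the winner of the toss moves the token from its position $(x_k,t_k)\in\Omega_T$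 to a point $(x_{k+1},t_{k+1})\in\mathcal A_\varepsilon(x_k,t_k)$. The game stops at the first index $\tau$ with $(x_\tau,t_\tau)\in\Gamma_\varepsilon$, and Player II then pays $F(x_\tau,t_\tau)$ to Player I. A strategy is a map that assigns to each partial history $((x_0,t_0),\dots,(x_k,t_k))$ with $(x_k,t_k)\in\Omega_T$ a point of $\mathcal A_\varepsilon(x_k,t_k)$. (No measurability of this map is required: for any two strategies the random positions are measurable functions of the coin tosses, because $(x_k,t_k)$ depends only on the first $k$ tosses.) Two strategies $S_I,S_{II}$ and the starting point determine a probability measure on the space of plays; let $\mathbb E^{(x_0,t_0)}_{S_I,S_{II}}$ be its expectation. Put $$u_I^\varepsilon(x_0,t_0)=\sup_{S_I}\inf_{S_{II}}\mathbb E^{(x_0,t_0)}_{S_I,S_{II}}[F(x_\tau,t_\tau)],\qquad u_{II}^\varepsilon(x_0,t_0)=\inf_{S_{II}}\sup_{S_I}\mathbb E^{(x_0,t_0)}_{S_I,S_{II}}[F(x_\tau,t_\tau)],$$ where $\tau=0$ if $(x_0,t_0)\in\Gamma_\varepsilon$. Then the game has an $\varepsilon$-value: $u_I^\varepsilon=u_{II}^\varepsilon$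 on $\Omega_T\cup\Gamma_\varepsilon$. -/

import Mathlib

open MeasureTheory

namespace TugOfWar

/-- Space-time points `(x, t)` with `x ∈ ℝ^N` (Euclidean norm) and `t ∈ ℝ`. -/
abbrev Point (N : ℕ) : Type := EuclideanSpace ℝ (Fin N) × ℝ

/-- The parabolic cylinder `Ω_T = Ω × (0, T]`. -/
def cylinder {N : ℕ} (Ω : Set (EuclideanSpace ℝ (Fin N))) (T : ℝ) : Set (Point N) :=
  Ω ×ˢ Set.Ioc 0 T

/-- The strip `Γ_r = Ω_r × (-r², 0] ∪ Θ_r × (0, T]` around the parabolic boundary, where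
`Ω_r = {x | dist (x, Ω) ≤ r}` and `Θ_r = {x ∉ Ω | dist (x, ∂Ω) ≤ r}`. -/
def strip {N : ℕ} (Ω : Set (EuclideanSpace ℝ (Fin N))) (T r : ℝ) : Set (Point N) :=
  Metric.cthickening r Ω ×ˢ Set.Ioc (-r ^ 2) 0 ∪
    (Ωᶜ ∩ Metric.cthickening r (frontier Ω)) ×ˢ Set.Ioc 0 T

/-- The condition on a set `K = 𝒜(x,t)`: it is a compact subset of `B(0,1) × [-c/2, c/2]`
that contains the origin. -/
structure IsAdmissible {N : ℕ} (c : ℝ) (K : Set (Point N)) : Prop where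
  isCompact : IsCompact K
  subset : K ⊆ Metric.ball 0 1 ×ˢ Set.Icc (-(c / 2)) (c / 2)
  zero_mem : (0, 0) ∈ K

/-- The set `𝒜_ε(x,t)` of possible movements: the points
`(x,t) + (ε y, ε² (1-c)/c s - ε² (c+1)/2)` with `(y,s) ∈ 𝒜(x,t)`. -/
def moves {N : ℕ} (c ε : ℝ) (A : Point N → Set (Point N)) (z : Point N) : Set (Point N) :=
  (fun p : Point N =>
    z + (ε • p.1, ε ^ 2 * ((1 - c) / c) * p.2 - ε ^ 2 * ((c + 1) / 2))) '' A z

/-- A strategy: given the partial history `h = (z₀, …, z_k)` whose last position lies in `Ω_T`,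
it selects the next position in `𝒜_ε(z_k)`. The values of `move` at other histories are
never used. -/
structure Strategy {N : ℕ} (Ω : Set (EuclideanSpace ℝ (Fin N))) (T c ε : ℝ)
    (A : Point N → Set (Point N)) where
  move : (k : ℕ) → (Fin (k + 1) → Point N) → Point N
  legal : ∀ (k : ℕ) (h : Fin (k + 1) → Point N), h (Fin.last k) ∈ cylinder Ω T →
    move k h ∈ moves c ε A (h (Fin.last k))

/-- The law of an infinite sequence of independent fair coin tosses;
`true` in toss `k` means that Player I wins that toss. -/
noncomputable def coinTosses : Measure (ℕ → Bool) :=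
  Measure.infinitePi fun _ : ℕ => (PMF.uniformOfFintype Bool).toMeasure

section Game

variable {N : ℕ} {Ω : Set (EuclideanSpace ℝ (Fin N))} {T c ε : ℝ}
  {A : Point N → Set (Point N)}

open Classical in
/-- The position that follows the partial history `h` when the toss has result `b`: as long as
the token is in `Ω_T`, the winner of the toss moves it; afterwards it rests. -/
noncomputable def nextPosition (S₁ S₂ : Strategy Ω T c ε A) (b : Bool) (k : ℕ)
    (h : Fin (k + 1) → Point N) : Point N :=
  if h (Fin.last k) ∈ cylinder Ω T then (if b then S₁.move k h else S₂.move k h)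
  else h (Fin.last k)

/-- The partial history `(z₀, …, z_k)` produced by the coin tosses `ω` when the game starts at
`z₀`, Player I uses `S₁` and Player II uses `S₂`. -/
noncomputable def history (S₁ S₂ : Strategy Ω T c ε A) (z₀ : Point N) (ω : ℕ → Bool) :
    (k : ℕ) → (Fin (k + 1) → Point N)
  | 0 => fun _ => z₀
  | k + 1 => Fin.snoc (α := fun _ => Point N) (history S₁ S₂ z₀ ω k)
      (nextPosition S₁ S₂ (ω k) k (history S₁ S₂ z₀ ω k))

/-- The play `(z₀, z₁, z₂, …)`. -/
noncomputable def play (S₁ S₂ : Strategy Ω T c ε A) (z₀ : Point N) (ω : ℕ → Bool) :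
    ℕ → Point N :=
  fun k => history S₁ S₂ z₀ ω k (Fin.last k)

/-- The random play depends measurably on the coin tosses, for all strategies: the first `k`
positions are functions of the first `k` tosses alone. -/
theorem measurable_play (S₁ S₂ : Strategy Ω T c ε A) (z₀ : Point N) :
    Measurable (play S₁ S₂ z₀) := by
  have key : ∀ (k : ℕ) (s : Set (Fin (k + 1) → Point N)),
      MeasurableSet {ω : ℕ → Bool | history S₁ S₂ z₀ ω k ∈ s} := by
    intro k
    induction k with
    | zero =>
      intro s
      exact MeasurableSet.const ((fun _ : Fin (0 + 1) => z₀) ∈ s)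
    | succ k ih =>
      intro s
      have hb : MeasurableSet {ω : ℕ → Bool | ω k = true} :=
        (measurable_pi_apply (X := fun _ : ℕ => Bool) k) (measurableSet_singleton true)
      have : {ω : ℕ → Bool | history S₁ S₂ z₀ ω (k + 1) ∈ s} =
          ({ω | ω k = true} ∩ {ω | history S₁ S₂ z₀ ω k ∈
              {h | Fin.snoc (α := fun _ => Point N) h (nextPosition S₁ S₂ true k h) ∈ s}}) ∪
          ({ω | ω k = true}ᶜ ∩ {ω | history S₁ S₂ z₀ ω k ∈
              {h | Fin.snoc (α := fun _ => Point N) h (nextPosition S₁ S₂ false k h) ∈ s}}) := by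
        ext ω
        cases hω : ω k <;> simp [history, hω]
      rw [this]
      exact (hb.inter (ih _)).union (hb.compl.inter (ih _))
  refine measurable_pi_iff.2 fun k s _ => ?_
  exact key k {h | h (Fin.last k) ∈ s}

/-- The probability measure `ℙ` on the space of plays determined by the starting point and the
strategies. -/
noncomputable def playLaw (S₁ S₂ : Strategy Ω T c ε A) (z₀ : Point N) :
    Measure (ℕ → Point N) :=
  coinTosses.map (play S₁ S₂ z₀)

/-- The number of rounds `τ` of a play: the first `k` with `z_k ∈ Γ_ε`. -/
noncomputable def rounds (Ω : Set (EuclideanSpace ℝ (Fin N))) (T ε : ℝ)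
    (p : ℕ → Point N) : ℕ :=
  sInf {k : ℕ | p k ∈ strip Ω T ε}

/-- The expected payoff `𝔼[F (x_τ, t_τ)]`. -/
noncomputable def expectedPayoff (F : Point N → ℝ) (S₁ S₂ : Strategy Ω T c ε A)
    (z₀ : Point N) : ℝ :=
  ∫ p, F (p (rounds Ω T ε p)) ∂(playLaw S₁ S₂ z₀)

end Game

/-- The `ε`-value of the game for Player I. -/
noncomputable def valueI {N : ℕ} (Ω : Set (EuclideanSpace ℝ (Fin N))) (T c ε : ℝ)
    (A : Point N → Set (Point N)) (F : Point N → ℝ) (z₀ : Point N) : ℝ :=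
  ⨆ S₁ : Strategy Ω T c ε A, ⨅ S₂ : Strategy Ω T c ε A, expectedPayoff F S₁ S₂ z₀

/-- The `ε`-value of the game for Player II. -/
noncomputable def valueII {N : ℕ} (Ω : Set (EuclideanSpace ℝ (Fin N))) (T c ε : ℝ)
    (A : Point N → Set (Point N)) (F : Point N → ℝ) (z₀ : Point N) : ℝ :=
  ⨅ S₂ : Strategy Ω T c ε A, ⨆ S₁ : Strategy Ω T c ε A, expectedPayoff F S₁ S₂ z₀

end TugOfWar

namespace TugOfWar

/-! Each move lowers the time by at least `c * ε ^ 2` and is too short to jump over the strip, so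
after `K ≥ T / (c * ε ^ 2)` rounds the token lies in `Γ_ε`, whatever the strategies
(`play_mem_strip`). The game thus has a finite horizon and is solved by backward induction: let `V 0
= F` off `Ω_T`, and on `Ω_T` let `V (n + 1)` be the mean of the supremum and the infimum of `V n`
over the legal moves (`truncatedValue`).

If Player I moves in round `k` to within `δ / (K + 1)` of the supremum of `V (K - (k + 1))`, then `V
(K - k)` along the play is a submartingale up to that error, against every opponent
(`sub_mul_le_integral_play`). Hence Player I secures `V K z₀ - δ`; symmetrically Player II concedes
at most `V K z₀ + δ`, and both values equal `V K z₀`.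

Measurability of `V n` plays no role: for fixed strategies only finitely many histories of a given
length occur. -/

/-! ### Symmetry of the coin tosses -/

instance : IsProbabilityMeasure coinTosses := by
  unfold coinTosses; infer_instance

/-- Reverse the result of toss `k`. -/
def flipToss (k : ℕ) (ω : ℕ → Bool) : ℕ → Bool :=
  fun i => (if i = k then Bool.not else id) (ω i)

theorem flipToss_self (k : ℕ) (ω : ℕ → Bool) : flipToss k ω k = !ω k := by
  simp [flipToss]

theorem flipToss_of_ne {k i : ℕ} (h : i ≠ k) (ω : ℕ → Bool) : flipToss k ω i = ω i := by
  simp [flipToss, h]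

theorem measurePreserving_not_uniform :
    MeasurePreserving Bool.not (PMF.uniformOfFintype Bool).toMeasure
      (PMF.uniformOfFintype Bool).toMeasure := by
  refine ⟨measurable_of_countable _, Measure.ext_of_singleton fun b => ?_⟩
  have : Bool.not ⁻¹' {b} = {!b} := by ext x; cases x <;> cases b <;> simp
  rw [Measure.map_apply (measurable_of_countable _) (measurableSet_singleton _), this]
  simp

/-- Averaging over `ω` and `flipToss k ω` serves as the conditional expectation given the tosses
before `k`. -/
theorem measurePreserving_flipToss (k : ℕ) :
    MeasurePreserving (flipToss k) coinTosses coinTosses := by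
  have hf : ∀ i : ℕ, MeasurePreserving (if i = k then Bool.not else id)
      (PMF.uniformOfFintype Bool).toMeasure (PMF.uniformOfFintype Bool).toMeasure := by
    intro i
    split_ifs
    · exact measurePreserving_not_uniform
    · exact MeasurePreserving.id _
  refine ⟨measurable_pi_iff.2 fun i => (hf i).measurable.comp (measurable_pi_apply i), ?_⟩
  unfold coinTosses flipToss
  rw [Measure.infinitePi_map_pi _ fun i => (hf i).measurable]
  congr 1
  funext i
  exact (hf i).map_eq

section Game

variable {N : ℕ} {Ω : Set (EuclideanSpace ℝ (Fin N))} {T c ε : ℝ}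
  {A : Point N → Set (Point N)}

/-! ### Histories and plays for fixed strategies -/

theorem history_congr (S₁ S₂ : Strategy Ω T c ε A) (z₀ : Point N) {ω ω' : ℕ → Bool} {k : ℕ}
    (h : ∀ i < k, ω i = ω' i) : history S₁ S₂ z₀ ω k = history S₁ S₂ z₀ ω' k := by
  induction k with
  | zero => rfl
  | succ k ih =>
    have := ih fun i hi => h i (hi.trans k.lt_succ_self)
    simp only [history, this, h k k.lt_succ_self]

/-- No measurability of `g` is required: on each of the two events decided by the last toss, the
value depends only on the shorter history. -/
theorem measurable_comp_history {β : Type*} [MeasurableSpace β] (S₁ S₂ : Strategy Ω T c ε A)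
    (z₀ : Point N) (k : ℕ) (g : (Fin (k + 1) → Point N) → β) :
    Measurable fun ω => g (history S₁ S₂ z₀ ω k) := by
  induction k with
  | zero => exact measurable_const (a := g fun _ => z₀)
  | succ k ih =>
    have hb : MeasurableSet {ω : ℕ → Bool | ω k = true} :=
      (measurable_pi_apply (X := fun _ : ℕ => Bool) k) (measurableSet_singleton true)
    set G := fun (b : Bool) (h : Fin (k + 1) → Point N) =>
      g (Fin.snoc (α := fun _ => Point N) h (nextPosition S₁ S₂ b k h)) with hG
    have heq : (fun ω => g (history S₁ S₂ z₀ ω (k + 1))) = fun ω =>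
        if ω k = true then G true (history S₁ S₂ z₀ ω k)
        else G false (history S₁ S₂ z₀ ω k) := by
      funext ω
      by_cases hω : ω k = true
      · simp [hG, history, hω]
      · simp [hG, history, Bool.eq_false_of_not_eq_true hω]
    rw [heq]
    exact Measurable.ite hb (ih (G true)) (ih (G false))

theorem finite_range_history (S₁ S₂ : Strategy Ω T c ε A) (z₀ : Point N) (k : ℕ) :
    (Set.range fun ω => history S₁ S₂ z₀ ω k).Finite := by
  induction k with
  | zero => exact (Set.finite_singleton fun _ => z₀).subset (by rintro _ ⟨ω, rfl⟩; rfl)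
  | succ k ih =>
    refine ((ih.prod (Set.finite_univ (α := Bool))).image fun q =>
      Fin.snoc (α := fun _ => Point N) q.1 (nextPosition S₁ S₂ q.2 k q.1)).subset ?_
    rintro _ ⟨ω, rfl⟩
    exact ⟨(history S₁ S₂ z₀ ω k, ω k), ⟨⟨ω, rfl⟩, trivial⟩, rfl⟩

theorem integrable_comp_history (S₁ S₂ : Strategy Ω T c ε A) (z₀ : Point N) (k : ℕ)
    (g : (Fin (k + 1) → Point N) → ℝ) :
    Integrable (fun ω => g (history S₁ S₂ z₀ ω k)) coinTosses := by
  obtain ⟨C, hC⟩ := ((finite_range_history S₁ S₂ z₀ k).image fun h => ‖g h‖).bddAbove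
  exact Integrable.of_bound (measurable_comp_history S₁ S₂ z₀ k g).aestronglyMeasurable C
    (Filter.Eventually.of_forall fun ω => hC ⟨_, ⟨ω, rfl⟩, rfl⟩)

theorem play_succ (S₁ S₂ : Strategy Ω T c ε A) (z₀ : Point N) (ω : ℕ → Bool) (k : ℕ) :
    play S₁ S₂ z₀ ω (k + 1) = nextPosition S₁ S₂ (ω k) k (history S₁ S₂ z₀ ω k) := by
  simp [play, history]

theorem play_succ_of_notMem (S₁ S₂ : Strategy Ω T c ε A) (z₀ : Point N) (ω : ℕ → Bool) {k : ℕ}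
    (h : play S₁ S₂ z₀ ω k ∉ cylinder Ω T) :
    play S₁ S₂ z₀ ω (k + 1) = play S₁ S₂ z₀ ω k := by
  exact (play_succ S₁ S₂ z₀ ω k).trans (if_neg h)

theorem play_succ_mem_moves (S₁ S₂ : Strategy Ω T c ε A) (z₀ : Point N) (ω : ℕ → Bool) {k : ℕ}
    (h : play S₁ S₂ z₀ ω k ∈ cylinder Ω T) :
    play S₁ S₂ z₀ ω (k + 1) ∈ moves c ε A (play S₁ S₂ z₀ ω k) := by
  have hk : play S₁ S₂ z₀ ω (k + 1) = if ω k then S₁.move k (history S₁ S₂ z₀ ω k)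
      else S₂.move k (history S₁ S₂ z₀ ω k) := (play_succ S₁ S₂ z₀ ω k).trans (if_pos h)
  rw [hk]
  split_ifs
  · exact S₁.legal k _ h
  · exact S₂.legal k _ h

theorem play_eq_of_le (S₁ S₂ : Strategy Ω T c ε A) (z₀ : Point N) (ω : ℕ → Bool) {j k : ℕ}
    (hj : play S₁ S₂ z₀ ω j ∉ cylinder Ω T) (hjk : j ≤ k) :
    play S₁ S₂ z₀ ω k = play S₁ S₂ z₀ ω j := by
  induction k, hjk using Nat.le_induction with
  | base => rfl
  | succ k _ ih => rw [play_succ_of_notMem _ _ _ _ (ih ▸ hj), ih]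

/-- If every round raises the mean of `f` by at least `-δ`, then so do `k` rounds up to `k δ`. -/
theorem sub_mul_le_integral_play (S₁ S₂ : Strategy Ω T c ε A) (z₀ : Point N)
    (f : ℕ → Point N → ℝ) {δ : ℝ} (hδ : 0 ≤ δ) {K : ℕ}
    (hmove : ∀ k < K, ∀ h : Fin (k + 1) → Point N, h (Fin.last k) ∈ cylinder Ω T →
      f k (h (Fin.last k)) - δ ≤ (f (k + 1) (S₁.move k h) + f (k + 1) (S₂.move k h)) / 2)
    (hrest : ∀ k < K, ∀ z ∉ cylinder Ω T, f k z ≤ f (k + 1) z) :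
    f 0 z₀ - K * δ ≤ ∫ ω, f K (play S₁ S₂ z₀ ω K) ∂coinTosses := by
  have hint : ∀ k, Integrable (fun ω => f k (play S₁ S₂ z₀ ω k)) coinTosses := fun k =>
    integrable_comp_history S₁ S₂ z₀ k fun h => f k (h (Fin.last k))
  have main : ∀ k ≤ K, f 0 z₀ - k * δ ≤ ∫ ω, f k (play S₁ S₂ z₀ ω k) ∂coinTosses := by
    intro k
    induction k with
    | zero => intro _; simp [play, history]
    | succ k ih =>
      intro hk
      have hflip := measurePreserving_flipToss k
      have hm : AEStronglyMeasurable (fun ω => f (k + 1) (play S₁ S₂ z₀ ω (k + 1)))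
        (Measure.map (flipToss k) coinTosses) := by
        rw [hflip.map_eq]; exact (hint (k + 1)).aestronglyMeasurable
      have hint' : Integrable (fun ω => f (k + 1) (play S₁ S₂ z₀ (flipToss k ω) (k + 1)))
          coinTosses := hflip.integrable_comp_of_integrable (hint (k + 1))
      have heq : ∫ ω, f (k + 1) (play S₁ S₂ z₀ (flipToss k ω) (k + 1)) ∂coinTosses =
          ∫ ω, f (k + 1) (play S₁ S₂ z₀ ω (k + 1)) ∂coinTosses := by
        rw [← integral_map hflip.measurable.aemeasurable hm, hflip.map_eq]
      -- `ω` and its flip share the history up to round `k`, and in that round each player wins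
      -- under exactly one of them.
      have hpt : ∀ ω, f k (play S₁ S₂ z₀ ω k) - δ ≤ (f (k + 1) (play S₁ S₂ z₀ ω (k + 1)) +
          f (k + 1) (play S₁ S₂ z₀ (flipToss k ω) (k + 1))) / 2 := by
        intro ω
        have hh : history S₁ S₂ z₀ (flipToss k ω) k = history S₁ S₂ z₀ ω k :=
          history_congr S₁ S₂ z₀ fun i hi => flipToss_of_ne hi.ne ω
        rw [play_succ, play_succ, hh, flipToss_self]
        by_cases hc : history S₁ S₂ z₀ ω k (Fin.last k) ∈ cylinder Ω T
        · have := hmove k hk _ hc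
          cases ω k <;> simp only [nextPosition, hc, if_true, play, Bool.not_true,
            Bool.not_false, Bool.false_eq_true, if_false] <;> linarith
        · have := hrest k hk _ hc
          simp only [nextPosition, hc, if_false, play]
          linarith
      have hle := integral_mono ((hint k).sub (integrable_const δ))
        (((hint (k + 1)).add hint').div_const 2) hpt
      simp only [Pi.sub_apply, Pi.add_apply] at hle
      rw [integral_sub (hint k) (integrable_const δ), integral_div,
        integral_add (hint (k + 1)) hint', heq] at hle
      simp only [integral_const, probReal_univ, one_smul] at hle
      have := ih (Nat.le_of_succ_le hk)
      push_cast
      linarith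
  exact main K le_rfl

/-! ### Geometry of the moves and termination -/

theorem cylinder_disjoint_strip {z : Point N} {r : ℝ} (hz : z ∈ strip Ω T r) :
    z ∉ cylinder Ω T := by
  rintro ⟨h1, h2⟩
  rcases hz with ⟨_, h⟩ | ⟨h, _⟩
  · exact absurd h.2 (not_le.2 h2.1)
  · exact h.1 h1

theorem strip_mono {r s : ℝ} (hr : 0 ≤ r) (h : r ≤ s) : strip Ω T r ⊆ strip Ω T s := by
  have h2 : -s ^ 2 ≤ -r ^ 2 := neg_le_neg (pow_le_pow_left₀ hr h 2)
  exact Set.union_subset_union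
    (Set.prod_mono (Metric.cthickening_mono h _) (Set.Ioc_subset_Ioc_left h2))
    (Set.prod_mono (Set.inter_subset_inter_right _ (Metric.cthickening_mono h _)) subset_rfl)

/-- The time increment is increasing and affine in `s`; it equals `-ε ^ 2` at `s = -c / 2` and `-c *
ε ^ 2` at `s = c / 2`. -/
theorem moves_time_le {z w : Point N} (hε : 0 < ε) (hc0 : 0 < c) (hc1 : c < 1)
    (hA : IsAdmissible c (A z)) (hw : w ∈ moves c ε A z) :
    z.2 - ε ^ 2 ≤ w.2 ∧ w.2 ≤ z.2 - c * ε ^ 2 := by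
  obtain ⟨p, hp, rfl⟩ := hw
  obtain ⟨h1, h2⟩ := (hA.subset hp).2
  have hq : 0 ≤ ε ^ 2 * ((1 - c) / c) := by
    have : 0 < 1 - c := by linarith
    positivity
  have e : ε ^ 2 * ((1 - c) / c) * (c / 2) = ε ^ 2 * (1 - c) / 2 := by field_simp
  have := mul_le_mul_of_nonneg_left h1 hq
  have := mul_le_mul_of_nonneg_left h2 hq
  simp only [Prod.snd_add]
  constructor <;> nlinarith

theorem moves_dist_lt {z w : Point N} (hε : 0 < ε) (hA : IsAdmissible c (A z))
    (hw : w ∈ moves c ε A z) : dist w.1 z.1 < ε := by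
  obtain ⟨p, hp, rfl⟩ := hw
  have h : ‖p.1‖ < 1 := mem_ball_zero_iff.1 (hA.subset hp).1
  simp only [Prod.fst_add, dist_eq_norm, add_sub_cancel_left, norm_smul, Real.norm_eq_abs,
    abs_of_pos hε]
  nlinarith

theorem moves_subset {z : Point N} (hε : 0 < ε) (hc0 : 0 < c) (hc1 : c < 1)
    (hA : IsAdmissible c (A z)) (hz : z ∈ cylinder Ω T) :
    moves c ε A z ⊆ cylinder Ω T ∪ strip Ω T ε := by
  intro w hw
  obtain ⟨ht1, ht2⟩ := moves_time_le hε hc0 hc1 hA hw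
  have hd := moves_dist_lt hε hA hw
  obtain ⟨hzΩ, hz0, hzT⟩ := hz
  have hpos : 0 < c * ε ^ 2 := by positivity
  by_cases h0 : w.2 ≤ 0
  · exact Or.inr (Or.inl ⟨Metric.mem_cthickening_of_dist_le _ _ _ _ hzΩ hd.le, by linarith, h0⟩)
  · push Not at h0
    have hw2 : w.2 ∈ Set.Ioc 0 T := ⟨h0, by linarith⟩
    by_cases hwΩ : w.1 ∈ Ω
    · exact Or.inl ⟨hwΩ, hw2⟩
    · refine Or.inr (Or.inr ⟨⟨hwΩ, ?_⟩, hw2⟩)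
      -- The distance from `w.1` to `Ω` is attained on the frontier, and it is at most the distance
      -- to `z.1`, which is below `ε`.
      obtain ⟨y, hy, hyd⟩ := exists_mem_frontier_infDist_compl_eq_dist (s := Ωᶜ) hwΩ
        (by rw [Ne, Set.compl_univ_iff]; exact Set.nonempty_iff_ne_empty.1 ⟨_, hzΩ⟩)
      rw [frontier_compl] at hy
      rw [compl_compl] at hyd
      exact Metric.mem_cthickening_of_dist_le _ _ _ _ hy
        (hyd ▸ (Metric.infDist_le_dist_of_mem hzΩ).trans hd.le)

theorem moves_nonempty {z : Point N} (hA : IsAdmissible c (A z)) : (moves c ε A z).Nonempty :=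
  ⟨_, (0, 0), hA.zero_mem, rfl⟩

theorem play_mem (hε : 0 < ε) (hc0 : 0 < c) (hc1 : c < 1)
    (hA : ∀ z ∈ cylinder Ω T, IsAdmissible c (A z)) (S₁ S₂ : Strategy Ω T c ε A)
    {z₀ : Point N} (hz₀ : z₀ ∈ cylinder Ω T ∪ strip Ω T ε) (ω : ℕ → Bool) (k : ℕ) :
    play S₁ S₂ z₀ ω k ∈ cylinder Ω T ∪ strip Ω T ε := by
  induction k with
  | zero => exact hz₀
  | succ k ih =>
    by_cases h : play S₁ S₂ z₀ ω k ∈ cylinder Ω T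
    · exact moves_subset hε hc0 hc1 (hA _ h) h (play_succ_mem_moves _ _ _ _ h)
    · rwa [play_succ_of_notMem _ _ _ _ h]

theorem play_mem_strip (hε : 0 < ε) (hc0 : 0 < c) (hc1 : c < 1)
    (hA : ∀ z ∈ cylinder Ω T, IsAdmissible c (A z)) (S₁ S₂ : Strategy Ω T c ε A)
    {z₀ : Point N} (hz₀ : z₀ ∈ cylinder Ω T ∪ strip Ω T ε) (ω : ℕ → Bool) {K : ℕ}
    (hK : T ≤ K * (c * ε ^ 2)) : play S₁ S₂ z₀ ω K ∈ strip Ω T ε := by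
  have key : ∀ k : ℕ, play S₁ S₂ z₀ ω k ∈ cylinder Ω T →
      (play S₁ S₂ z₀ ω k).2 ≤ T - k * (c * ε ^ 2) := by
    intro k
    induction k with
    | zero => intro h; simpa using h.2.2
    | succ k ih =>
      intro h
      by_cases hk : play S₁ S₂ z₀ ω k ∈ cylinder Ω T
      · have := (moves_time_le hε hc0 hc1 (hA _ hk) (play_succ_mem_moves _ _ _ _ hk)).2
        have := ih hk
        push_cast
        linarith
      · exact absurd (play_succ_of_notMem _ _ _ _ hk ▸ h) hk
  refine (play_mem hε hc0 hc1 hA S₁ S₂ hz₀ ω K).resolve_left fun h => ?_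
  have := key K h
  have := h.2.1
  linarith

/-- The expected payoff is the mean of `F` at the position after a number of rounds that is
large enough for the game to be over. -/
theorem expectedPayoff_eq (F : Point N → ℝ) (hε : 0 < ε) (hc0 : 0 < c) (hc1 : c < 1)
    (hA : ∀ z ∈ cylinder Ω T, IsAdmissible c (A z)) (S₁ S₂ : Strategy Ω T c ε A)
    {z₀ : Point N} (hz₀ : z₀ ∈ cylinder Ω T ∪ strip Ω T ε) {K : ℕ}
    (hK : T ≤ K * (c * ε ^ 2)) :
    expectedPayoff F S₁ S₂ z₀ = ∫ ω, F (play S₁ S₂ z₀ ω K) ∂coinTosses := by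
  have hend : ∀ ω, play S₁ S₂ z₀ ω K ∈ strip Ω T ε := fun ω =>
    play_mem_strip hε hc0 hc1 hA S₁ S₂ hz₀ ω hK
  have hrounds : ∀ ω, play S₁ S₂ z₀ ω (rounds Ω T ε (play S₁ S₂ z₀ ω)) = play S₁ S₂ z₀ ω K := by
    intro ω
    have hmem : rounds Ω T ε (play S₁ S₂ z₀ ω) ∈ {k | play S₁ S₂ z₀ ω k ∈ strip Ω T ε} :=
      Nat.sInf_mem ⟨K, hend ω⟩
    exact (play_eq_of_le S₁ S₂ z₀ ω (cylinder_disjoint_strip hmem) (Nat.sInf_le (hend ω))).symm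
  have hhist : ∀ ω (k : ℕ) (i : Fin (k + 1)),
      history S₁ S₂ z₀ ω k i = play S₁ S₂ z₀ ω i := by
    intro ω k
    induction k with
    | zero => intro i; fin_cases i; rfl
    | succ k ih =>
      intro i
      induction i using Fin.lastCases with
      | last => rfl
      | cast i => simp only [history, Fin.snoc_castSucc, ih, Fin.val_castSucc]
  -- The token rests from round `K` on, so capping the index at `K` recovers the whole play from a
  -- finite history.
  have hplay : ∀ ω, play S₁ S₂ z₀ ω = fun k =>
      history S₁ S₂ z₀ ω K ⟨min k K, Nat.lt_succ_of_le (min_le_right _ _)⟩ := by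
    intro ω
    funext k
    rw [hhist]
    rcases le_total k K with h | h
    · simp [h]
    · simpa [h] using play_eq_of_le S₁ S₂ z₀ ω (cylinder_disjoint_strip (hend ω)) h
  have hfin : (Set.range (play S₁ S₂ z₀)).Finite := by
    refine ((finite_range_history S₁ S₂ z₀ K).image fun h k =>
      h ⟨min k K, Nat.lt_succ_of_le (min_le_right _ _)⟩).subset ?_
    rintro _ ⟨ω, rfl⟩
    exact ⟨_, ⟨ω, rfl⟩, (hplay ω).symm⟩
  -- The law of the play is carried by a finite set, and a function vanishing off a countable set is
  -- measurable, whatever `F` and `rounds` are.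
  have hmeas : AEStronglyMeasurable (fun p => F (p (rounds Ω T ε p)))
      (coinTosses.map (play S₁ S₂ z₀)) := by
    have h1 : Measurable ((Set.range (play S₁ S₂ z₀)).indicator
        fun p => F (p (rounds Ω T ε p))) := by
      refine (measurable_const (a := (0 : ℝ))).measurable_of_countable_ne
        (hfin.countable.mono fun p hp => ?_)
      by_contra hn
      exact hp (by rw [Set.indicator_of_notMem hn])
    refine ⟨_, h1.stronglyMeasurable, ?_⟩
    have hae : ∀ᵐ p ∂coinTosses.map (play S₁ S₂ z₀), p ∈ Set.range (play S₁ S₂ z₀) :=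
      (ae_map_iff (measurable_play S₁ S₂ z₀).aemeasurable hfin.measurableSet).2
        (Filter.Eventually.of_forall Set.mem_range_self)
    filter_upwards [hae] with p hp
    exact (Set.indicator_of_mem hp fun p => F (p (rounds Ω T ε p))).symm
  rw [expectedPayoff, playLaw, integral_map (measurable_play S₁ S₂ z₀).aemeasurable hmeas]
  exact integral_congr_ae (Filter.Eventually.of_forall fun ω => congrArg F (hrounds ω))

/-! ### Backward induction -/

open Classical in
/-- The value of the game that is broken off with payoff `0` after `n` rounds. -/
noncomputable def truncatedValue (Ω : Set (EuclideanSpace ℝ (Fin N))) (T c ε : ℝ)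
    (A : Point N → Set (Point N)) (F : Point N → ℝ) : ℕ → Point N → ℝ
  | 0, z => if z ∈ cylinder Ω T then 0 else F z
  | n + 1, z => if z ∈ cylinder Ω T then
      (sSup (truncatedValue Ω T c ε A F n '' moves c ε A z) +
        sInf (truncatedValue Ω T c ε A F n '' moves c ε A z)) / 2 else F z

theorem truncatedValue_of_notMem (F : Point N → ℝ) (n : ℕ) {z : Point N}
    (hz : z ∉ cylinder Ω T) : truncatedValue Ω T c ε A F n z = F z := by
  cases n <;> simp [truncatedValue, hz]

/-- This bound makes the `sSup` and `sInf` in `truncatedValue` genuine, not default values. -/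
theorem abs_truncatedValue_le {F : Point N → ℝ} {M : ℝ} (hM : 0 ≤ M)
    (hF : ∀ z ∈ strip Ω T ε, |F z| ≤ M) (hε : 0 < ε) (hc0 : 0 < c) (hc1 : c < 1)
    (hA : ∀ z ∈ cylinder Ω T, IsAdmissible c (A z)) (n : ℕ) :
    ∀ z ∈ cylinder Ω T ∪ strip Ω T ε, |truncatedValue Ω T c ε A F n z| ≤ M := by
  induction n with
  | zero =>
    rintro z (hz | hz)
    · simpa [truncatedValue, hz] using hM
    · rw [truncatedValue_of_notMem F 0 (cylinder_disjoint_strip hz)]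
      exact hF z hz
  | succ n ih =>
    rintro z (hz | hz)
    · simp only [truncatedValue, hz, if_true]
      have hb : ∀ y ∈ truncatedValue Ω T c ε A F n '' moves c ε A z, -M ≤ y ∧ y ≤ M := by
        rintro _ ⟨w, hw, rfl⟩
        exact abs_le.1 (ih w (moves_subset hε hc0 hc1 (hA z hz) hz hw))
      have hne := (moves_nonempty (ε := ε) (hA z hz)).image (truncatedValue Ω T c ε A F n)
      obtain ⟨y, hy⟩ := hne
      have h1 := csSup_le ⟨y, hy⟩ fun y hy => (hb y hy).2
      have h2 := le_csInf ⟨y, hy⟩ fun y hy => (hb y hy).1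
      have h3 := (hb y hy).1.trans (le_csSup ⟨M, fun y hy => (hb y hy).2⟩ hy)
      have h4 := (csInf_le ⟨-M, fun y hy => (hb y hy).1⟩ hy).trans (hb y hy).2
      rw [abs_le]
      constructor <;> linarith
    · rw [truncatedValue_of_notMem F _ (cylinder_disjoint_strip hz)]
      exact hF z hz

/-- A strategy obtained by choosing, in each round, a move that satisfies `P`. -/
theorem exists_strategy (P : ℕ → Point N → Point N → Prop)
    (hP : ∀ k, ∀ z ∈ cylinder Ω T, ∃ w ∈ moves c ε A z, P k z w) :
    ∃ S : Strategy Ω T c ε A, ∀ (k : ℕ) (h : Fin (k + 1) → Point N),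
      h (Fin.last k) ∈ cylinder Ω T → P k (h (Fin.last k)) (S.move k h) := by
  have : ∀ k z, ∃ w, z ∈ cylinder Ω T → w ∈ moves c ε A z ∧ P k z w := by
    intro k z
    by_cases hz : z ∈ cylinder Ω T
    · obtain ⟨w, hw⟩ := hP k z hz
      exact ⟨w, fun _ => hw⟩
    · exact ⟨z, fun h => absurd h hz⟩
  choose m hm using this
  exact ⟨⟨fun k h => m k (h (Fin.last k)), fun k h hh => (hm k _ hh).1⟩,
    fun k h hh => (hm k _ hh).2⟩

end Game

end TugOfWar

/-! ### Minimax and conclusion -/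

/-- Near-optimal choices on both sides squeeze the two iterated extrema to `v`. The bound `M` keeps
all real suprema and infima from being default values. -/
theorem sup_inf_eq_inf_sup_of_approx {α β : Type*} {f : α → β → ℝ} {M v : ℝ}
    (hM : ∀ a b, |f a b| ≤ M)
    (h1 : ∀ δ > 0, ∃ a, ∀ b, v - δ ≤ f a b) (h2 : ∀ δ > 0, ∃ b, ∀ a, f a b ≤ v + δ) :
    ⨆ a, ⨅ b, f a b = ⨅ b, ⨆ a, f a b := by
  obtain ⟨a₀, -⟩ := h1 1 one_pos
  obtain ⟨b₀, -⟩ := h2 1 one_pos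
  have : Nonempty α := ⟨a₀⟩
  have : Nonempty β := ⟨b₀⟩
  have hbelow : ∀ a, BddBelow (Set.range fun b => f a b) := fun a =>
    ⟨-M, by rintro _ ⟨b, rfl⟩; exact (abs_le.1 (hM a b)).1⟩
  have habove : ∀ b, BddAbove (Set.range fun a => f a b) := fun b =>
    ⟨M, by rintro _ ⟨a, rfl⟩; exact (abs_le.1 (hM a b)).2⟩
  have hI : BddAbove (Set.range fun a => ⨅ b, f a b) :=
    ⟨M, by rintro _ ⟨a, rfl⟩; exact (ciInf_le (hbelow a) b₀).trans (abs_le.1 (hM a b₀)).2⟩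
  have hII : BddBelow (Set.range fun b => ⨆ a, f a b) :=
    ⟨-M, by rintro _ ⟨b, rfl⟩; exact (abs_le.1 (hM a₀ b)).1.trans (le_ciSup (habove b) a₀)⟩
  refine le_antisymm (ciSup_le fun a => le_ciInf fun b =>
    (ciInf_le (hbelow a) b).trans (le_ciSup (habove b) a)) ?_
  refine le_of_forall_pos_le_add fun δ hδ => ?_
  obtain ⟨a, ha⟩ := h1 (δ / 2) (half_pos hδ)
  obtain ⟨b, hb⟩ := h2 (δ / 2) (half_pos hδ)
  have e1 : v - δ / 2 ≤ ⨆ a, ⨅ b, f a b := (le_ciInf ha).trans (le_ciSup hI a)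
  have e2 : ⨅ b, ⨆ a, f a b ≤ v + δ / 2 := (ciInf_le hII b).trans (ciSup_le hb)
  linarith

theorem mainTheorem5 (N : ℕ) (Ω : Set (EuclideanSpace ℝ (Fin N)))
    (hΩ_open : IsOpen Ω) (hΩ_bdd : Bornology.IsBounded Ω)
    (T : ℝ) (hT : 0 < T) (c : ℝ) (hc0 : 0 < c) (hc1 : c < 1)
    (A : TugOfWar.Point N → Set (TugOfWar.Point N))
    (hA : ∀ z ∈ TugOfWar.cylinder Ω T, TugOfWar.IsAdmissible c (A z))
    (η : ℝ) (hη : 0 < η) (F : TugOfWar.Point N → ℝ)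
    (hF_borel : Measurable fun z : TugOfWar.strip Ω T η => F z)
    (hF_bdd : ∃ M : ℝ, ∀ z ∈ TugOfWar.strip Ω T η, |F z| ≤ M)
    (ε : ℝ) (hε0 : 0 < ε) (hεη : ε ≤ η) :
    ∀ z ∈ TugOfWar.cylinder Ω T ∪ TugOfWar.strip Ω T ε,
      TugOfWar.valueI Ω T c ε A F z = TugOfWar.valueII Ω T c ε A F z := by
  open TugOfWar in
  intro z₀ hz₀
  obtain ⟨M₀, hM₀⟩ := hF_bdd
  obtain ⟨M, hM, hF⟩ : ∃ M : ℝ, 0 ≤ M ∧ ∀ z ∈ strip Ω T ε, |F z| ≤ M :=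
    ⟨max M₀ 0, le_max_right _ _, fun z hz =>
      (hM₀ z (strip_mono hε0.le hεη hz)).trans (le_max_left _ _)⟩
  obtain ⟨K, hK⟩ : ∃ K : ℕ, T ≤ K * (c * ε ^ 2) := by
    obtain ⟨K, hK⟩ := exists_nat_ge (T / (c * ε ^ 2))
    exact ⟨K, (div_le_iff₀ (by positivity)).1 hK⟩
  have hpay := fun S₁ S₂ : Strategy Ω T c ε A =>
    expectedPayoff_eq F hε0 hc0 hc1 hA S₁ S₂ hz₀ hK
  set V : ℕ → Point N → ℝ := truncatedValue Ω T c ε A F with hV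
  have hVout : ∀ n, ∀ z ∉ cylinder Ω T, V n z = F z := fun n z hz =>
    truncatedValue_of_notMem F n hz
  have hVsucc : ∀ n, ∀ z ∈ cylinder Ω T,
      V (n + 1) z = (sSup (V n '' moves c ε A z) + sInf (V n '' moves c ε A z)) / 2 :=
    fun n z hz => by simp [hV, truncatedValue, hz]
  have hVb : ∀ n, ∀ z ∈ cylinder Ω T, ∀ w ∈ moves c ε A z, |V n w| ≤ M := fun n z hz w hw =>
    abs_truncatedValue_le hM hF hε0 hc0 hc1 hA n w (moves_subset hε0 hc0 hc1 (hA z hz) hz hw)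
  have hub : ∀ n, ∀ z ∈ cylinder Ω T, BddAbove (V n '' moves c ε A z) := fun n z hz =>
    ⟨M, by rintro _ ⟨w, hw, rfl⟩; exact (abs_le.1 (hVb n z hz w hw)).2⟩
  have hlb : ∀ n, ∀ z ∈ cylinder Ω T, BddBelow (V n '' moves c ε A z) := fun n z hz =>
    ⟨-M, by rintro _ ⟨w, hw, rfl⟩; exact (abs_le.1 (hVb n z hz w hw)).1⟩
  have hne : ∀ n, ∀ z ∈ cylinder Ω T, (V n '' moves c ε A z).Nonempty := fun n z hz =>
    (moves_nonempty (hA z hz)).image _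
  -- The index `K - K` matches the potential `V (K - k)` at `k = K`, with `K - k` rounds left.
  have hpayV : ∀ S₁ S₂ : Strategy Ω T c ε A,
      expectedPayoff F S₁ S₂ z₀ = ∫ ω, V (K - K) (play S₁ S₂ z₀ ω K) ∂coinTosses := by
    intro S₁ S₂
    rw [hpay]
    refine integral_congr_ae (Filter.Eventually.of_forall fun ω => (hVout _ _ ?_).symm)
    exact cylinder_disjoint_strip (play_mem_strip hε0 hc0 hc1 hA S₁ S₂ hz₀ ω hK)
  -- Dividing by `K + 1` makes the total error over `K` rounds at most `δ` and avoids a separate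
  -- proof that `K ≠ 0`.
  have hscale : ∀ δ : ℝ, 0 < δ → 0 < δ / (K + 1) ∧ K * (δ / (K + 1)) ≤ δ := by
    intro δ hδ
    refine ⟨by positivity, ?_⟩
    rw [← mul_div_assoc, div_le_iff₀ (by positivity)]
    nlinarith
  refine sup_inf_eq_inf_sup_of_approx (M := M) (v := V K z₀) (fun S₁ S₂ => ?_)
    (fun δ hδ => ?_) (fun δ hδ => ?_)
  · rw [hpay, ← Real.norm_eq_abs]
    refine (norm_integral_le_of_norm_le_const (Filter.Eventually.of_forall fun ω =>
      hF _ (play_mem_strip hε0 hc0 hc1 hA S₁ S₂ hz₀ ω hK))).trans ?_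
    simp
  · obtain ⟨hδ', hδK⟩ := hscale δ hδ
    obtain ⟨S₁, hS₁⟩ := exists_strategy (Ω := Ω) (T := T) (c := c) (ε := ε) (A := A)
      (fun k z w => sSup (V (K - (k + 1)) '' moves c ε A z) - δ / (K + 1) ≤ V (K - (k + 1)) w)
      fun k z hz => by
        obtain ⟨_, ⟨w, hw, rfl⟩, h⟩ := exists_lt_of_lt_csSup (hne (K - (k + 1)) z hz)
          (sub_lt_self _ hδ')
        exact ⟨w, hw, h.le⟩
    refine ⟨S₁, fun S₂ => ?_⟩
    rw [hpayV]
    have := sub_mul_le_integral_play S₁ S₂ z₀ (fun k => V (K - k)) hδ'.le (K := K)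
      (fun k hk h hh => by
        have e1 := hS₁ k h hh
        have e2 := csInf_le (hlb (K - (k + 1)) _ hh) ⟨_, S₂.legal k h hh, rfl⟩
        have e3 := hVsucc (K - (k + 1)) _ hh
        rw [show K - (k + 1) + 1 = K - k by omega] at e3
        linarith)
      (fun k hk z hz => by simp only [hVout _ z hz, le_refl])
    simp only [Nat.sub_zero] at this
    linarith
  · obtain ⟨hδ', hδK⟩ := hscale δ hδ
    obtain ⟨S₂, hS₂⟩ := exists_strategy (Ω := Ω) (T := T) (c := c) (ε := ε) (A := A)
      (fun k z w => V (K - (k + 1)) w ≤ sInf (V (K - (k + 1)) '' moves c ε A z) + δ / (K + 1))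
      fun k z hz => by
        obtain ⟨_, ⟨w, hw, rfl⟩, h⟩ := exists_lt_of_csInf_lt (hne (K - (k + 1)) z hz)
          (lt_add_of_pos_right _ hδ')
        exact ⟨w, hw, h.le⟩
    refine ⟨S₂, fun S₁ => ?_⟩
    rw [hpayV]
    -- The sign change turns Player II's supermartingale estimate into the submartingale one.
    have := sub_mul_le_integral_play S₁ S₂ z₀ (fun k z => -V (K - k) z) hδ'.le (K := K)
      (fun k hk h hh => by
        have e1 := hS₂ k h hh
        have e2 := le_csSup (hub (K - (k + 1)) _ hh) ⟨_, S₁.legal k h hh, rfl⟩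
        have e3 := hVsucc (K - (k + 1)) _ hh
        rw [show K - (k + 1) + 1 = K - k by omega] at e3
        linarith)
      (fun k hk z hz => by simp only [hVout _ z hz, le_refl])
    rw [integral_neg] at this
    simp only [Nat.sub_zero] at this
    linarith
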